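/- Let $H$ be a real separable Hilbert space and let $\mu$ be a Borel probability measure on $H$ with bounded support; write $\operatorname{diam}(\mu)$ for the diameter of $\operatorname{supp}(\mu)$. For $d\in\mathbb N$ let $$e_2(\mu,d)=\inf_{L}\Big(\int_H \operatorname{dist}^2(x,L)\,d\mu(x)\Big)^{1/2},$$ where the infimum is over all $d$-dimensional affine subspaces $L$ of $H$. For $X=(x_0,\dots,x_{d+1})\in H^{d+2}$ let $M_{d+1}(X)$ be the $(d+1)$-volume of the parallelotope generated by $x_1-x_0,\dots,x_{d+1}-x_0$, let $\operatorname{diam}(X)=\max_{i,j}\|x_i-x_j\|$, let $$\operatorname{p_d\sin}_{x_i}(X)=\frac{M_{d+1}(X)}{\prod_{0\le j\le d+1,\ j\ne i}\|x_j-x_i\|}$$ if the points $x_0,\dots,x_{d+1}$ are pairwise distinct and $\operatorname{p_d\sin}_{x_i}(X)=0$ otherwise, and define the polar geometric condition number $$c_{\mathrm{pol}}(X)=\operatorname{diam}(X)\,\sqrt{\frac{\sum_{i=0}^{d+1}\operatorname{p_d\sin}^2_{x_i}(X)}{d+2}}.$$ For $\gamma>0$, $\mu$ is called $\gamma$-regular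 with constant $C\ge 1$ if $$\frac{t^\gamma}{C}\le\mu(B(x,t))\le C\,t^\gamma\qquad\text{for all }x\in\operatorname{supp}(\mu),\ 0<t\le\operatorname{diam}(\mu),$$ where $B(x,t)$ is the closed ball, and $\gamma$-upper-regular with constant $C$ if the upper bound holds; the least such $C$ is the regularity constant of $\mu$. **Theorem.** Suppose that either $\mu$ is $\gamma$-upper-regular with constant $C$ for some $\gamma>2$, or $d=1$ and $\mu$ is $\gamma$-regular with constant $C$ for some $\gamma>1$. Then $c_{\mathrm{pol}}^2$ is $\mu^{d+2}$-integrable and $$\int_{H^{d+2}}c_{\mathrm{pol}}^2(X)\,d\mu^{d+2}(X)\le K\,e_2^2(\mu,d),$$ where the constant $K>0$ depends only on $d$, $\gamma$, $\operatorname{diam}(\mu)$ and $C$. -/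

import Mathlib

open MeasureTheory

noncomputable section

namespace GCN

/-- The set `AG_d(H)` of `d`-flats of `H`, i.e. of (nonempty) affine subspaces of dimension `d`. -/
def affineGrassmannian (d : ℕ) (H : Type*) [NormedAddCommGroup H] [InnerProductSpace ℝ H] :
    Set (AffineSubspace ℝ H) :=
  {L | (L : Set H).Nonempty ∧ FiniteDimensional ℝ L.direction ∧ Module.finrank ℝ L.direction = d}

/-- The `d`-dimensional least squares error
`e₂(μ, d) = inf_{L ∈ AG_d(H)} (∫ dist(x, L)² dμ(x))^{1/2}`. -/
def lsError {H : Type*} [NormedAddCommGroup H] [InnerProductSpace ℝ H] [MeasurableSpace H]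
    (μ : Measure H) (d : ℕ) : ℝ :=
  ⨅ L : affineGrassmannian d H, √(∫ x, Metric.infDist x (L.1 : Set H) ^ 2 ∂μ)

/-- `diam(μ)`, the diameter of the support of `μ`. -/
def measureDiam {H : Type*} [NormedAddCommGroup H] [MeasurableSpace H] (μ : Measure H) : ℝ :=
  Metric.diam μ.support

/-- `M_n(X)`, the `n`-volume of a parallelotope generated by the vertices of the `n`-simplex
`X = (x₀, …, x_n)`: the square root of the Gram determinant of `x₁ - x₀, …, x_n - x₀`
(it does not depend on which vertex serves as the origin). -/
def parVolume {H : Type*} [NormedAddCommGroup H] [InnerProductSpace ℝ H] {n : ℕ}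
    (X : Fin (n + 1) → H) : ℝ :=
  √(Matrix.gram ℝ (fun i : Fin n => X i.succ - X 0)).det

/-- `diam(X)`, the maximal edge length of the simplex `X`. -/
def simplexDiam {H : Type*} [NormedAddCommGroup H] {n : ℕ} (X : Fin n → H) : ℝ :=
  Metric.diam (Set.range X)

open Classical in
/-- The `d`-dimensional polar sine of the `(d+1)`-simplex `X` with respect to its vertex `x_i`.
The condition says that the minimal edge length of `X` is positive. -/
def polarSine {H : Type*} [NormedAddCommGroup H] [InnerProductSpace ℝ H] {d : ℕ}
    (X : Fin (d + 2) → H) (i : Fin (d + 2)) : ℝ :=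
  if ∀ j k : Fin (d + 2), j ≠ k → 0 < ‖X j - X k‖ then
    parVolume X / ∏ j ∈ Finset.univ.erase i, ‖X j - X i‖
  else 0

/-- The polar geometric condition number
`c_pol(X) = diam(X) ((∑_{i=0}^{d+1} psin_{x_i}(X)²) / (d + 2))^{1/2}`. -/
def cPol {H : Type*} [NormedAddCommGroup H] [InnerProductSpace ℝ H] {d : ℕ}
    (X : Fin (d + 2) → H) : ℝ :=
  simplexDiam X * √((∑ i, polarSine X i ^ 2) / ((d : ℝ) + 2))

/-- `μ` is `γ`-upper-regular and `C ≥ 1` is a constant for this: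
`μ(B(x,t)) ≤ C t^γ` for all `x ∈ supp(μ)` and `0 < t ≤ diam(μ)`.
The least such `C` is the regularity constant. -/
def IsUpperRegularWith {H : Type*} [NormedAddCommGroup H] [MeasurableSpace H]
    (μ : Measure H) (γ C : ℝ) : Prop :=
  1 ≤ C ∧ ∀ x ∈ μ.support, ∀ t : ℝ, 0 < t → t ≤ measureDiam μ →
    μ.real (Metric.closedBall x t) ≤ C * t ^ γ

/-- `μ` is `γ`-regular and `C ≥ 1` is a constant for this:
`t^γ / C ≤ μ(B(x,t)) ≤ C t^γ` for all `x ∈ supp(μ)` and `0 < t ≤ diam(μ)`.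
The least such `C` is the regularity constant. -/
def IsRegularWith {H : Type*} [NormedAddCommGroup H] [MeasurableSpace H]
    (μ : Measure H) (γ C : ℝ) : Prop :=
  1 ≤ C ∧ ∀ x ∈ μ.support, ∀ t : ℝ, 0 < t → t ≤ measureDiam μ →
    t ^ γ / C ≤ μ.real (Metric.closedBall x t) ∧ μ.real (Metric.closedBall x t) ≤ C * t ^ γ

end GCN

end

noncomputable section

namespace GCN

/-! ### Polar sines, Gram determinants and distances to flats. -/

section LinearAlgebra

/-! The squared polar sine at a vertex is, up to a constant, the Gram determinant of the unit edge
vectors at that vertex. Given a `d`-flat with direction `V`, the projections of these `d + 1`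
vectors to `V` are linearly dependent. Evaluating the Gram form at the dependence coefficients
leaves only the components orthogonal to `V`, so the least eigenvalue is at most the sum of their
squared norms. The other eigenvalues are bounded by the trace, hence by `d + 1`. The orthogonal
component of an edge is at most the sum of the distances of its endpoints to the flat. This gives
`polarSine_sq_le_sum`: the squared polar sine is bounded by a sum of terms `dist(x, L)² / ‖x - y‖²`.

For `γ > 2` the potential `∫ ‖x - y‖⁻² dμ(y)` is bounded uniformly on the support by a dyadic sum
(`lintegral_inv_norm_sq_le`), and Tonelli turns each term into a multiple of `∫ dist(x, L)² dμ`.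

For `d = 1` and `γ > 1` that potential may diverge, but `e₂` is bounded below: an `ε`-tube about a
line is covered by `O(1/ε)` balls of mass `O(ε^γ)`, so for small `ε` at least half of the mass lies
outside it. As `c_pol` is bounded on the support, the inequality follows (`le_integral_infDist_sq`).
-/

theorem det_le_eigenvalue_mul_trace_pow {n : Type*} [Fintype n] [DecidableEq n]
    {G : Matrix n n ℝ} (hG : G.PosSemidef) (i : n) :
    G.det ≤ hG.1.eigenvalues i * G.trace ^ (Fintype.card n - 1) := by
  have h0 := hG.eigenvalues_nonneg
  have hle : ∀ j, hG.1.eigenvalues j ≤ G.trace := by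
    intro j
    rw [hG.1.trace_eq_sum_eigenvalues]
    exact Finset.single_le_sum (f := fun i => hG.1.eigenvalues i) (fun i _ => h0 i)
      (Finset.mem_univ j)
  rw [hG.1.det_eq_prod_eigenvalues]
  simp only [RCLike.ofReal_real_eq_id, id]
  rw [← Finset.mul_prod_erase _ _ (Finset.mem_univ i)]
  refine mul_le_mul_of_nonneg_left ?_ (h0 i)
  refine (Finset.prod_le_prod (fun j _ => h0 j) fun j _ => hle j).trans_eq ?_
  rw [Finset.prod_const, Finset.card_erase_of_mem (Finset.mem_univ i), Finset.card_univ]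

/-- In an orthonormal eigenbasis both quadratic forms are diagonal, and the eigenvalue bound applies
coordinate by coordinate. -/
theorem det_mul_dotProduct_le {n : Type*} [Fintype n] [DecidableEq n] {G : Matrix n n ℝ}
    (hG : G.PosSemidef) (a : n → ℝ) :
    G.det * (a ⬝ᵥ a) ≤ G.trace ^ (Fintype.card n - 1) * (a ⬝ᵥ G.mulVec a) := by
  set U : Matrix n n ℝ := (hG.1.eigenvectorUnitary : Matrix n n ℝ) with hU
  have hUU : U * U.transpose = 1 := by
    have := Unitary.coe_mul_star_self hG.1.eigenvectorUnitary
    simpa [Matrix.star_eq_conjTranspose] using this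
  have hspec : G = U * Matrix.diagonal hG.1.eigenvalues * U.transpose := by
    have := hG.1.spectral_theorem
    rw [Unitary.conjStarAlgAut_apply] at this
    simpa [Matrix.star_eq_conjTranspose, Function.comp_def] using this
  set b := U.transpose.mulVec a with hb
  have h1 : a ⬝ᵥ a = b ⬝ᵥ b := by
    rw [hb, Matrix.dotProduct_mulVec, Matrix.vecMul_transpose, Matrix.mulVec_mulVec, hUU,
      Matrix.one_mulVec]
  have h2 : a ⬝ᵥ G.mulVec a = b ⬝ᵥ (Matrix.diagonal hG.1.eigenvalues).mulVec b := by
    conv_lhs => rw [hspec]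
    rw [← Matrix.mulVec_mulVec, ← Matrix.mulVec_mulVec, Matrix.dotProduct_mulVec a U, hb,
      ← Matrix.mulVec_transpose]
  rw [h1, h2]
  simp only [dotProduct, Matrix.mulVec_diagonal, Finset.mul_sum]
  refine Finset.sum_le_sum fun i _ => ?_
  nlinarith [mul_le_mul_of_nonneg_right (det_le_eigenvalue_mul_trace_pow hG i)
    (mul_self_nonneg (b i))]

theorem det_le_trace_pow {n : Type*} [Fintype n] [DecidableEq n] {G : Matrix n n ℝ}
    (hG : G.PosSemidef) : G.det ≤ G.trace ^ Fintype.card n := by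
  have h0 := hG.eigenvalues_nonneg
  rw [hG.1.det_eq_prod_eigenvalues, hG.1.trace_eq_sum_eigenvalues]
  simp only [RCLike.ofReal_real_eq_id, id]
  refine (Finset.prod_le_prod (fun j _ => h0 j) fun j _ => Finset.single_le_sum
    (f := fun i => hG.1.eigenvalues i) (fun i _ => h0 i) (Finset.mem_univ j)).trans_eq ?_
  rw [Finset.prod_const, Finset.card_univ]

variable {H : Type*} [NormedAddCommGroup H] [InnerProductSpace ℝ H]

theorem det_gram_sum_smul {n : Type*} [Fintype n] [DecidableEq n] (M : Matrix n n ℝ)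
    (y : n → H) :
    (Matrix.gram ℝ fun k => ∑ l, M k l • y l).det = M.det ^ 2 * (Matrix.gram ℝ y).det := by
  have : (Matrix.gram ℝ fun k => ∑ l, M k l • y l) = M * Matrix.gram ℝ y * M.transpose := by
    ext i j
    simp only [Matrix.gram_apply, sum_inner, inner_sum, inner_smul_left, inner_smul_right,
      Matrix.mul_apply, Matrix.transpose_apply, Finset.sum_mul]
    refine Finset.sum_congr rfl fun k _ => ?_
    rw [Finset.mul_sum]
    refine Finset.sum_congr rfl fun l _ => ?_
    rw [conj_trivial, real_inner_comm]
    ring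
  rw [this, Matrix.det_mul, Matrix.det_mul, Matrix.det_transpose]
  ring

theorem det_gram_smul {n : Type*} [Fintype n] [DecidableEq n] (c : n → ℝ) (y : n → H) :
    (Matrix.gram ℝ fun k => c k • y k).det = (∏ k, c k) ^ 2 * (Matrix.gram ℝ y).det := by
  rw [← Matrix.det_diagonal, ← det_gram_sum_smul]
  simp [Matrix.diagonal_apply, ite_smul]

theorem trace_gram {n : Type*} [Fintype n] (y : n → H) :
    (Matrix.gram ℝ y).trace = ∑ k, ‖y k‖ ^ 2 := by
  simp [Matrix.trace]

/-- The matrix expressing the edges of a simplex at its first vertex in terms of the edges at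
its vertex `i`. -/
def baseChange (d : ℕ) (i : Fin (d + 2)) : Matrix (Fin (d + 1)) (Fin (d + 1)) ℝ :=
  Matrix.of fun k l => (if i.succAbove l = k.succ then 1 else 0) - if i.succAbove l = 0 then 1 else 0

theorem sum_baseChange_smul {d : ℕ} (X : Fin (d + 2) → H) (i : Fin (d + 2)) (k : Fin (d + 1)) :
    ∑ l, baseChange d i k l • (X (i.succAbove l) - X i) = X k.succ - X 0 := by
  -- The term `j = i` vanishes, so the sum over the other vertices may be taken over all vertices,
  -- where the indicators select `k.succ` and `0`.
  have h := Fin.sum_univ_succAbove (fun j : Fin (d + 2) =>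
    ((if j = k.succ then (1 : ℝ) else 0) - if j = 0 then 1 else 0) • (X j - X i)) i
  simp only [sub_self, smul_zero, zero_add] at h
  simp only [baseChange, Matrix.of_apply]
  rw [← h]
  simp [sub_smul, Finset.sum_sub_distrib, ite_smul]

/-- Changing the base vertex costs a factor depending only on `d` and `i`; its exact value plays no
role. -/
theorem det_gram_eq_baseChange {d : ℕ} (X : Fin (d + 2) → H) (i : Fin (d + 2)) :
    (Matrix.gram ℝ fun k : Fin (d + 1) => X k.succ - X 0).det =
      (baseChange d i).det ^ 2 *
        (Matrix.gram ℝ fun l : Fin (d + 1) => X (i.succAbove l) - X i).det := by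
  rw [← det_gram_sum_smul]
  simp only [sum_baseChange_smul]

/-- The squared polar sine through the Gram determinant of the unit edge vectors at `X i`. -/
theorem polarSine_sq_le {d : ℕ} (X : Fin (d + 2) → H) (i : Fin (d + 2)) :
    polarSine X i ^ 2 ≤ (baseChange d i).det ^ 2 *
      (Matrix.gram ℝ fun l : Fin (d + 1) =>
        ‖X (i.succAbove l) - X i‖⁻¹ • (X (i.succAbove l) - X i)).det := by
  unfold polarSine
  split_ifs with h
  · have hprod : ∏ j ∈ Finset.univ.erase i, ‖X j - X i‖ =
        ∏ l : Fin (d + 1), ‖X (i.succAbove l) - X i‖ := by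
      -- The factor at `i` is replaced by `1`, so that splitting it off leaves the product
      -- unchanged.
      have := Fin.prod_univ_succAbove
        (fun j : Fin (d + 2) => if j = i then (1 : ℝ) else ‖X j - X i‖) i
      simp only [if_true, one_mul, Fin.succAbove_ne, if_false] at this
      rw [← this, ← Finset.mul_prod_erase _ _ (Finset.mem_univ i)]
      simp only [if_true, one_mul]
      exact Finset.prod_congr rfl fun j hj => by simp [Finset.ne_of_mem_erase hj]
    rw [det_gram_smul, div_pow, parVolume, Real.sq_sqrt (Matrix.posSemidef_gram ℝ _).det_nonneg,
      det_gram_eq_baseChange X i, hprod, Finset.prod_inv_distrib, inv_pow, div_eq_mul_inv]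
    exact le_of_eq (by ring)
  · rw [zero_pow two_ne_zero]
    exact mul_nonneg (sq_nonneg _) (Matrix.posSemidef_gram ℝ _).det_nonneg

theorem norm_inv_norm_smul_le_one (x : H) : ‖‖x‖⁻¹ • x‖ ≤ 1 := by
  rw [norm_smul, norm_inv, norm_norm]
  exact inv_mul_le_one

theorem trace_gram_le {n : Type*} [Fintype n] {u : n → H} (hu : ∀ l, ‖u l‖ ≤ 1) :
    (Matrix.gram ℝ u).trace ≤ Fintype.card n := by
  rw [trace_gram]
  refine (Finset.sum_le_sum fun k _ => pow_le_one₀ (norm_nonneg _) (hu k)).trans ?_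
  simp

/-- The Gram determinant of `d + 1` vectors of norm at most one is controlled by their distances
to any `d`-dimensional linear subspace. -/
theorem det_gram_le_sum_sq {d : ℕ} (V : Submodule ℝ H) [FiniteDimensional ℝ V]
    (hV : Module.finrank ℝ V = d) {u : Fin (d + 1) → H} (hu : ∀ l, ‖u l‖ ≤ 1) :
    (Matrix.gram ℝ u).det ≤ ((d : ℝ) + 1) ^ d * ∑ l, ‖Vᗮ.starProjection (u l)‖ ^ 2 := by
  -- These are `d + 1` vectors in a space of dimension `d`; the coefficients `a` of a dependence
  -- serve as test vector for the Gram form.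
  have hdep : ¬ LinearIndependent ℝ fun l => V.orthogonalProjectionOnto (u l) := by
    intro h
    have := h.fintype_card_le_finrank
    simp [hV] at this
  obtain ⟨a, ha, l₀, hl₀⟩ := Fintype.not_linearIndependent_iff.1 hdep
  have hpos : 0 < a ⬝ᵥ a := by
    have : a ⬝ᵥ a = ∑ l, a l ^ 2 := by simp [dotProduct, sq]
    rw [this]
    exact Finset.sum_pos' (fun _ _ => sq_nonneg _) ⟨l₀, Finset.mem_univ _, by positivity⟩
  have hproj : ∑ l, a l • u l = ∑ l, a l • Vᗮ.starProjection (u l) := by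
    have h0 : ∑ l, a l • V.starProjection (u l) = 0 := by
      have := congrArg (fun z : V => (z : H)) ha
      simpa using this
    have h1 : ∀ l, u l = V.starProjection (u l) + Vᗮ.starProjection (u l) := fun l =>
      (V.starProjection_add_starProjection_orthogonal (u l)).symm
    calc ∑ l, a l • u l = ∑ l, (a l • V.starProjection (u l) + a l • Vᗮ.starProjection (u l)) :=
          Finset.sum_congr rfl fun l _ => by rw [← smul_add, ← h1]
      _ = _ := by rw [Finset.sum_add_distrib, h0, zero_add]
  have hquad : a ⬝ᵥ (Matrix.gram ℝ u).mulVec a ≤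
      (a ⬝ᵥ a) * ∑ l, ‖Vᗮ.starProjection (u l)‖ ^ 2 := by
    have h := Matrix.star_dotProduct_gram_mulVec (𝕜 := ℝ) u a a
    rw [star_trivial] at h
    rw [h, hproj, real_inner_self_eq_norm_sq]
    calc ‖∑ l, a l • Vᗮ.starProjection (u l)‖ ^ 2
        ≤ (∑ l, |a l| * ‖Vᗮ.starProjection (u l)‖) ^ 2 := by
          gcongr
          refine (norm_sum_le _ _).trans_eq ?_
          simp [norm_smul]
      _ ≤ (∑ l, |a l| ^ 2) * ∑ l, ‖Vᗮ.starProjection (u l)‖ ^ 2 :=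
          Finset.sum_mul_sq_le_sq_mul_sq _ _ _
      _ = _ := by simp [dotProduct, sq]
  have htr : (Matrix.gram ℝ u).trace ^ d ≤ ((d : ℝ) + 1) ^ d := by
    have h := trace_gram_le hu
    rw [Fintype.card_fin, Nat.cast_succ] at h
    exact pow_le_pow_left₀ (Matrix.posSemidef_gram ℝ u).trace_nonneg h d
  have hmain := det_mul_dotProduct_le (Matrix.posSemidef_gram ℝ u) a
  rw [Fintype.card_fin, Nat.add_sub_cancel] at hmain
  refine le_of_mul_le_mul_right (hmain.trans ?_) hpos
  calc _ ≤ ((d : ℝ) + 1) ^ d * ((a ⬝ᵥ a) * ∑ l, ‖Vᗮ.starProjection (u l)‖ ^ 2) := by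
        refine mul_le_mul htr hquad ?_ (by positivity)
        simpa using (Matrix.posSemidef_gram ℝ u).dotProduct_mulVec_nonneg a
    _ = _ := by ring

theorem det_gram_le_of_norm_le_one {d : ℕ} {u : Fin (d + 1) → H} (hu : ∀ l, ‖u l‖ ≤ 1) :
    (Matrix.gram ℝ u).det ≤ ((d : ℝ) + 1) ^ (d + 1) := by
  refine (det_le_trace_pow (Matrix.posSemidef_gram ℝ u)).trans ?_
  have h := trace_gram_le hu
  rw [Fintype.card_fin, Nat.cast_succ] at h
  rw [Fintype.card_fin]
  exact pow_le_pow_left₀ (Matrix.posSemidef_gram ℝ u).trace_nonneg h _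

/-- A constant for the comparison of the polar sines with distances to flats. -/
def sineConst (d : ℕ) : ℝ :=
  2 * ((d : ℝ) + 1) ^ (d + 1) * ∑ i, (baseChange d i).det ^ 2

theorem sineConst_nonneg (d : ℕ) : 0 ≤ sineConst d := by unfold sineConst; positivity

theorem sq_det_baseChange_le (d : ℕ) (i : Fin (d + 2)) :
    (baseChange d i).det ^ 2 ≤ ∑ i, (baseChange d i).det ^ 2 :=
  Finset.single_le_sum (f := fun i => (baseChange d i).det ^ 2) (fun _ _ => sq_nonneg _)
    (Finset.mem_univ i)

theorem polarSine_sq_le_sineConst {d : ℕ} (X : Fin (d + 2) → H) (i : Fin (d + 2)) :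
    polarSine X i ^ 2 ≤ sineConst d := by
  refine (polarSine_sq_le X i).trans ?_
  calc _ ≤ (∑ i, (baseChange d i).det ^ 2) * ((d : ℝ) + 1) ^ (d + 1) :=
        mul_le_mul (sq_det_baseChange_le d i)
          (det_gram_le_of_norm_le_one fun _ => norm_inv_norm_smul_le_one _)
          (Matrix.posSemidef_gram ℝ _).det_nonneg (by positivity)
    _ ≤ _ := by
        unfold sineConst
        have : 0 ≤ (∑ i, (baseChange d i).det ^ 2) * ((d : ℝ) + 1) ^ (d + 1) := by positivity
        linarith

/-- The component of `z - p` orthogonal to the direction does not depend on `p ∈ L`, so its norm is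
at most `‖z - q‖` for every `q ∈ L`. -/
theorem norm_starProjection_orthogonal_sub_le {L : AffineSubspace ℝ H}
    (hL : (L : Set H).Nonempty) [FiniteDimensional ℝ L.direction] (x y : H) :
    ‖L.directionᗮ.starProjection (x - y)‖ ≤
      Metric.infDist x (L : Set H) + Metric.infDist y (L : Set H) := by
  obtain ⟨p, hp⟩ := hL
  have key : ∀ z, ‖L.directionᗮ.starProjection (z - p)‖ ≤ Metric.infDist z (L : Set H) := by
    intro z
    refine (Metric.le_infDist ⟨p, hp⟩).2 fun q hq => ?_
    have h0 : L.directionᗮ.starProjection (q - p) = 0 := by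
      rw [Submodule.starProjection_apply_eq_zero_iff, Submodule.orthogonal_orthogonal]
      exact L.vsub_mem_direction hq hp
    have : z - p = (z - q) + (q - p) := by abel
    rw [this, map_add, h0, add_zero, dist_eq_norm]
    exact Submodule.norm_starProjection_apply_le _ _
  have : x - y = (x - p) - (y - p) := by abel
  rw [this, map_sub]
  exact (norm_sub_le _ _).trans (add_le_add (key x) (key y))

theorem polarSine_sq_le_sum {d : ℕ} {L : AffineSubspace ℝ H} (hL : L ∈ affineGrassmannian d H)
    (X : Fin (d + 2) → H) (i : Fin (d + 2)) :
    polarSine X i ^ 2 ≤ sineConst d * ∑ l : Fin (d + 1),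
      (Metric.infDist (X (i.succAbove l)) (L : Set H) ^ 2 + Metric.infDist (X i) (L : Set H) ^ 2) *
        (‖X (i.succAbove l) - X i‖ ^ 2)⁻¹ := by
  obtain ⟨hne, hfin, hrank⟩ := hL
  refine (polarSine_sq_le X i).trans ?_
  set S := ∑ l : Fin (d + 1), (Metric.infDist (X (i.succAbove l)) (L : Set H) ^ 2 +
    Metric.infDist (X i) (L : Set H) ^ 2) * (‖X (i.succAbove l) - X i‖ ^ 2)⁻¹ with hS
  have hS0 : 0 ≤ S := by positivity
  have hsum : ∑ l : Fin (d + 1), ‖L.directionᗮ.starProjection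
      (‖X (i.succAbove l) - X i‖⁻¹ • (X (i.succAbove l) - X i))‖ ^ 2 ≤ 2 * S := by
    rw [hS, Finset.mul_sum]
    refine Finset.sum_le_sum fun l _ => ?_
    rw [map_smul, norm_smul, norm_inv, norm_norm, mul_pow, inv_pow, mul_comm, ← mul_assoc]
    refine mul_le_mul_of_nonneg_right ?_ (by positivity)
    refine (pow_le_pow_left₀ (norm_nonneg _)
      (norm_starProjection_orthogonal_sub_le hne _ _) 2).trans ?_
    exact add_sq_le
  have h := det_gram_le_sum_sq L.direction hrank
    (u := fun l => ‖X (i.succAbove l) - X i‖⁻¹ • (X (i.succAbove l) - X i))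
    fun _ => norm_inv_norm_smul_le_one _
  -- The exponent `d` is raised to `d + 1` so that `sineConst` serves both here and in the uniform
  -- bound; its factor 2 comes from squaring a sum of two distances.
  have h1 : (1 : ℝ) ≤ (d : ℝ) + 1 := by simp
  calc _ ≤ (∑ i, (baseChange d i).det ^ 2) * (((d : ℝ) + 1) ^ (d + 1) * (2 * S)) :=
        mul_le_mul (sq_det_baseChange_le d i)
          (h.trans (mul_le_mul (pow_le_pow_right₀ h1 d.le_succ) hsum (by positivity)
            (by positivity))) (Matrix.posSemidef_gram ℝ _).det_nonneg (by positivity)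
    _ = _ := by unfold sineConst; ring

theorem nonempty_affineGrassmannian {d : ℕ} {u : Fin (d + 1) → H} (hu : LinearIndependent ℝ u) :
    Nonempty (affineGrassmannian d H) := by
  have h := hu.comp Fin.castSucc (Fin.castSucc_injective d)
  refine ⟨⟨(Submodule.span ℝ (Set.range (u ∘ Fin.castSucc))).toAffineSubspace,
    ⟨0, Submodule.zero_mem _⟩, ?_, ?_⟩⟩
  · rw [Submodule.toAffineSubspace_direction]
    exact FiniteDimensional.span_of_finite ℝ (Set.finite_range _)
  · rw [Submodule.toAffineSubspace_direction, finrank_span_eq_card h, Fintype.card_fin]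

/-- Without `d`-flats there are no `d + 1` independent edges, so every volume is zero. This covers
the case where `lsError` is an infimum over the empty set. -/
theorem cPol_eq_zero_of_isEmpty {d : ℕ} (h : IsEmpty (affineGrassmannian d H))
    (X : Fin (d + 2) → H) : cPol X = 0 := by
  have hdet : (Matrix.gram ℝ fun k : Fin (d + 1) => X k.succ - X 0).det = 0 := by
    by_contra hne
    exact h.elim
      (nonempty_affineGrassmannian (Matrix.linearIndependent_of_det_gram_ne_zero hne)).some
  simp [cPol, polarSine, parVolume, hdet]

end LinearAlgebra

/-! ### Measurability of the condition number. -/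

section Measurability

variable {H : Type*} [NormedAddCommGroup H]

theorem simplexDiam_nonneg {n : ℕ} (X : Fin n → H) : 0 ≤ simplexDiam X := Metric.diam_nonneg

theorem continuous_simplexDiam {n : ℕ} : Continuous (simplexDiam : (Fin n → H) → ℝ) := by
  -- The constant is 2 because both endpoints of an edge move by at most `dist X Y`.
  refine (LipschitzWith.of_le_add_mul 2 fun X Y => ?_).continuous
  refine Metric.diam_le_of_forall_dist_le (add_nonneg (simplexDiam_nonneg Y) (by positivity)) ?_
  rintro _ ⟨i, rfl⟩ _ ⟨j, rfl⟩
  have h1 : dist (Y i) (Y j) ≤ simplexDiam Y :=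
    Metric.dist_le_diam_of_mem (Set.finite_range Y).isBounded ⟨i, rfl⟩ ⟨j, rfl⟩
  have h2 := dist_le_pi_dist X Y i
  have h3 := dist_le_pi_dist X Y j
  have h4 := dist_triangle4 (X i) (Y i) (Y j) (X j)
  rw [dist_comm (Y j)] at h4
  have : ((2 : NNReal) : ℝ) = 2 := rfl
  rw [this]
  linarith

variable [InnerProductSpace ℝ H]

theorem continuous_parVolume {n : ℕ} : Continuous (parVolume : (Fin (n + 1) → H) → ℝ) := by
  unfold parVolume
  refine Real.continuous_sqrt.comp (Continuous.matrix_det ?_)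
  refine continuous_matrix fun i j => ?_
  simp only [Matrix.gram_apply]
  fun_prop

variable [TopologicalSpace.SeparableSpace H] [MeasurableSpace H] [BorelSpace H]

theorem measurable_polarSine {d : ℕ} (i : Fin (d + 2)) :
    Measurable fun X : Fin (d + 2) → H => polarSine X i := by
  have : SecondCountableTopology H := UniformSpace.secondCountable_of_separable H
  unfold polarSine
  refine Measurable.ite ?_ ?_ measurable_const
  · simp only [Set.ofPred_forall]
    refine MeasurableSet.iInter fun j => MeasurableSet.iInter fun k =>
      MeasurableSet.iInter fun _ => measurableSet_lt measurable_const (by fun_prop)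
  · refine continuous_parVolume.measurable.div ?_
    fun_prop

theorem measurable_cPol {d : ℕ} : Measurable fun X : Fin (d + 2) → H => cPol X := by
  have : SecondCountableTopology H := UniformSpace.secondCountable_of_separable H
  unfold cPol
  refine continuous_simplexDiam.measurable.mul (Measurable.sqrt ?_)
  refine Measurable.div_const (Finset.measurable_sum _ fun i _ => ?_) _
  exact (measurable_polarSine i).pow_const 2

end Measurability

/-! ### Integrability, uniform bounds and passage to the infimum. -/

section Bounds

theorem simplexDiam_le {H : Type*} [NormedAddCommGroup H] [MeasurableSpace H]
    {μ : Measure H} (hb : Bornology.IsBounded μ.support) {n : ℕ} {X : Fin n → H}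
    (hX : ∀ j, X j ∈ μ.support) : simplexDiam X ≤ measureDiam μ := by
  refine Metric.diam_le_of_forall_dist_le Metric.diam_nonneg ?_
  rintro _ ⟨i, rfl⟩ _ ⟨j, rfl⟩
  exact Metric.dist_le_diam_of_mem hb (hX i) (hX j)

theorem ae_mem_support {H : Type*} [NormedAddCommGroup H] [MeasurableSpace H]
    [TopologicalSpace.SeparableSpace H] {μ : Measure H} : ∀ᵐ x ∂μ, x ∈ μ.support := by
  have : SecondCountableTopology H := UniformSpace.secondCountable_of_separable H
  exact Measure.support_mem_ae

theorem ae_pi_mem_support {H : Type*} [NormedAddCommGroup H] [MeasurableSpace H]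
    [TopologicalSpace.SeparableSpace H] {μ : Measure H} [IsProbabilityMeasure μ] {n : ℕ} :
    ∀ᵐ X ∂(Measure.pi fun _ : Fin n => μ), ∀ j, X j ∈ μ.support := by
  rw [ae_all_iff]
  intro j
  exact (measurePreserving_eval (fun _ : Fin n => μ) j).quasiMeasurePreserving.ae ae_mem_support

theorem integrable_infDist_sq {H : Type*} [NormedAddCommGroup H] [MeasurableSpace H]
    [BorelSpace H] [TopologicalSpace.SeparableSpace H] {μ : Measure H} [IsProbabilityMeasure μ]
    (hb : Bornology.IsBounded μ.support) (s : Set H) :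
    Integrable (fun x => Metric.infDist x s ^ 2) μ := by
  have hm : AEStronglyMeasurable (fun x => Metric.infDist x s ^ 2) μ :=
    ((Metric.continuous_infDist_pt s).pow 2).measurable.aestronglyMeasurable
  obtain ⟨x₀, hx₀⟩ : μ.support.Nonempty := (ae_mem_support (μ := μ)).exists
  refine Integrable.of_bound hm ((Metric.infDist x₀ s + measureDiam μ) ^ 2) ?_
  filter_upwards [ae_mem_support] with x hx
  rw [Real.norm_of_nonneg (sq_nonneg _)]
  refine pow_le_pow_left₀ Metric.infDist_nonneg ?_ 2
  exact Metric.infDist_le_infDist_add_dist.trans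
    (add_le_add_right (Metric.dist_le_diam_of_mem hb hx hx₀) _)

variable {H : Type*} [NormedAddCommGroup H] [InnerProductSpace ℝ H]

theorem cPol_sq {d : ℕ} (X : Fin (d + 2) → H) :
    cPol X ^ 2 = simplexDiam X ^ 2 * ((∑ i, polarSine X i ^ 2) / ((d : ℝ) + 2)) := by
  rw [cPol, mul_pow, Real.sq_sqrt (by positivity)]

variable [MeasurableSpace H] {μ : Measure H}

theorem cPol_sq_le_sum (hb : Bornology.IsBounded μ.support) {d : ℕ} {X : Fin (d + 2) → H}
    (hX : ∀ j, X j ∈ μ.support) : cPol X ^ 2 ≤ measureDiam μ ^ 2 * ∑ i, polarSine X i ^ 2 := by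
  rw [cPol_sq]
  refine mul_le_mul (pow_le_pow_left₀ (simplexDiam_nonneg X) (simplexDiam_le hb hX) 2) ?_
    (by positivity) (by positivity)
  refine div_le_self (by positivity) ?_
  have : (0 : ℝ) ≤ d := d.cast_nonneg
  linarith

theorem cPol_sq_le (hb : Bornology.IsBounded μ.support) {d : ℕ} {X : Fin (d + 2) → H}
    (hX : ∀ j, X j ∈ μ.support) :
    cPol X ^ 2 ≤ measureDiam μ ^ 2 * (((d : ℝ) + 2) * sineConst d) := by
  refine (cPol_sq_le_sum hb hX).trans (mul_le_mul_of_nonneg_left ?_ (sq_nonneg _))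
  refine (Finset.sum_le_sum fun i _ => polarSine_sq_le_sineConst X i).trans_eq ?_
  simp

/-- The infimum is over square roots, so the bound passes to it as `√(A / K)`; for an empty family
it is `0`, whence the hypothesis `h0`. -/
theorem le_mul_lsError_sq {d : ℕ} {A K : ℝ} (hK : 0 < K)
    (h0 : IsEmpty (affineGrassmannian d H) → A ≤ 0)
    (h : ∀ L ∈ affineGrassmannian d H, A ≤ K * ∫ x, Metric.infDist x (L : Set H) ^ 2 ∂μ) :
    A ≤ K * lsError μ d ^ 2 := by
  rcases isEmpty_or_nonempty (affineGrassmannian d H) with he | he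
  · exact (h0 he).trans (by positivity)
  · have hs : √(A / K) ≤ lsError μ d := by
      refine le_ciInf fun L => Real.sqrt_le_sqrt ?_
      rw [div_le_iff₀' hK]
      exact h L.1 L.2
    have := (Real.sqrt_le_iff.1 hs).2
    rwa [div_le_iff₀' hK] at this

variable [BorelSpace H] [TopologicalSpace.SeparableSpace H] [IsProbabilityMeasure μ]

theorem integrable_cPol_sq (hb : Bornology.IsBounded μ.support) {d : ℕ} :
    Integrable (fun X : Fin (d + 2) → H => cPol X ^ 2) (Measure.pi fun _ => μ) := by
  refine Integrable.of_bound (measurable_cPol.pow_const 2).aestronglyMeasurable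
    (measureDiam μ ^ 2 * (((d : ℝ) + 2) * sineConst d)) ?_
  filter_upwards [ae_pi_mem_support] with X hX
  rw [Real.norm_of_nonneg (sq_nonneg _)]
  exact cPol_sq_le hb hX

theorem integral_cPol_sq_le (hb : Bornology.IsBounded μ.support) {d : ℕ} :
    ∫ X : Fin (d + 2) → H, cPol X ^ 2 ∂(Measure.pi fun _ => μ) ≤
      measureDiam μ ^ 2 * (((d : ℝ) + 2) * sineConst d) := by
  refine (integral_mono_ae (integrable_cPol_sq hb) (integrable_const _) ?_).trans_eq
    (by rw [integral_const, probReal_univ, one_smul])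
  filter_upwards [ae_pi_mem_support] with X hX using cPol_sq_le hb hX

end Bounds

/-! ### The inverse square potential and the case `γ > 2`. -/

section Kernel

/-- If `D / 2^(k+1) < ‖x - y‖ ≤ D / 2^k`, the `k`-th term alone dominates. For `x = y` the left side
is `0` since `0⁻¹ = 0`. -/
theorem inv_norm_sq_le_tsum {H : Type*} [NormedAddCommGroup H] {x y : H} {D : ℝ} (hD : ‖x - y‖ ≤ D) :
    ENNReal.ofReal (‖x - y‖ ^ 2)⁻¹ ≤ ∑' k : ℕ, (Metric.closedBall x (D / 2 ^ k)).indicator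
      (fun _ => ENNReal.ofReal (4 * 4 ^ k / D ^ 2)) y := by
  rcases (norm_nonneg (x - y)).eq_or_lt with h0 | h0
  · simp [← h0]
  obtain ⟨k, hk1, hk2⟩ := exists_nat_pow_near (x := D / ‖x - y‖) (y := 2)
    ((one_le_div h0).2 hD) one_lt_two
  refine le_trans ?_ (ENNReal.le_tsum k)
  have hmem : y ∈ Metric.closedBall x (D / 2 ^ k) := by
    rw [Metric.mem_closedBall, dist_comm, dist_eq_norm, le_div_iff₀ (by positivity), mul_comm]
    rwa [le_div_iff₀ h0] at hk1
  rw [Set.indicator_of_mem hmem]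
  refine ENNReal.ofReal_le_ofReal ?_
  have hDpos := h0.trans_le hD
  rw [div_lt_iff₀ h0] at hk2
  rw [inv_le_comm₀ (by positivity) (by positivity), inv_div, div_le_iff₀ (by positivity)]
  calc D ^ 2 ≤ (2 ^ (k + 1) * ‖x - y‖) ^ 2 := pow_le_pow_left₀ hDpos.le hk2.le 2
    _ = _ := by rw [mul_pow, ← pow_mul, mul_comm (k + 1), pow_mul, pow_succ]; norm_num; ring

/-- Distinct coordinates of a product measure are independent with law `μ`. -/
theorem map_pi_pair {Ω : Type*} [MeasurableSpace Ω] {μ : Measure Ω} [IsProbabilityMeasure μ]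
    {n : ℕ} {i j : Fin n} (hij : i ≠ j) :
    (Measure.pi fun _ : Fin n => μ).map (fun X => (X i, X j)) = μ.prod μ := by
  have hind := (ProbabilityTheory.iIndepFun_pi (μ := fun _ : Fin n => μ) (X := fun _ => id)
    fun _ => aemeasurable_id).indepFun hij
  have h := (ProbabilityTheory.indepFun_iff_map_prod_eq_prod_map_map
    (measurable_pi_apply i).aemeasurable (measurable_pi_apply j).aemeasurable).1 hind
  have hmap : ∀ k : Fin n, (Measure.pi fun _ : Fin n => μ).map (fun X => X k) = μ := fun k =>
    (measurePreserving_eval (fun _ : Fin n => μ) k).map_eq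
  rw [hmap, hmap] at h
  exact h

variable {H : Type*} [NormedAddCommGroup H] [MeasurableSpace H]
  [BorelSpace H] [TopologicalSpace.SeparableSpace H] {μ : Measure H} [IsProbabilityMeasure μ]

/-- A bound for the potential `∫ ‖x - y‖⁻² dμ(y)` of a `γ`-upper-regular measure, `γ > 2`. -/
def potentialConst (γ D C : ℝ) : ℝ :=
  4 * C * D ^ (γ - 2) * (1 - (2 : ℝ) ^ (2 - γ))⁻¹

/-- Upper regularity turns the dyadic sum into a geometric series of ratio `4 / 2^γ = 2^(2 - γ)`,
which is less than one because `γ > 2`. -/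
theorem lintegral_inv_norm_sq_le {γ C : ℝ} (hb : Bornology.IsBounded μ.support)
    (hγ : 2 < γ) (hD : 0 < measureDiam μ) (hμ : IsUpperRegularWith μ γ C) {x : H}
    (hx : x ∈ μ.support) :
    ∫⁻ y, ENNReal.ofReal (‖x - y‖ ^ 2)⁻¹ ∂μ ≤
      ENNReal.ofReal (potentialConst γ (measureDiam μ) C) := by
  set D := measureDiam μ with hDdef
  obtain ⟨hC, hreg⟩ := hμ
  set q : ℝ := 2 ^ (2 - γ) with hq
  have hq0 : 0 ≤ q := by positivity
  have hq1 : q < 1 := Real.rpow_lt_one_of_one_lt_of_neg one_lt_two (by linarith)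
  have hterm : ∀ k : ℕ, 4 * 4 ^ k / D ^ 2 * (C * (D / 2 ^ k) ^ γ) =
      4 * C * D ^ (γ - 2) * q ^ k := by
    intro k
    have h2 : (0 : ℝ) < 2 ^ k := by positivity
    have e1 : ((2 : ℝ) ^ k) ^ γ = ((2 : ℝ) ^ γ) ^ k := by
      rw [← Real.rpow_natCast, ← Real.rpow_natCast, ← Real.rpow_mul two_pos.le,
        ← Real.rpow_mul two_pos.le, mul_comm]
    have e2 : q = 4 / 2 ^ γ := by
      rw [hq, Real.rpow_sub two_pos]
      norm_num
    rw [Real.div_rpow hD.le h2.le, e1, e2, Real.rpow_sub hD, Real.rpow_two, div_pow]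
    field_simp
  calc ∫⁻ y, ENNReal.ofReal (‖x - y‖ ^ 2)⁻¹ ∂μ
      ≤ ∫⁻ y, ∑' k : ℕ, (Metric.closedBall x (D / 2 ^ k)).indicator
          (fun _ => ENNReal.ofReal (4 * 4 ^ k / D ^ 2)) y ∂μ := by
        refine lintegral_mono_ae ?_
        filter_upwards [ae_mem_support] with y hy
        refine inv_norm_sq_le_tsum ?_
        rw [← dist_eq_norm]
        exact Metric.dist_le_diam_of_mem hb hx hy
    _ = ∑' k : ℕ, ENNReal.ofReal (4 * 4 ^ k / D ^ 2) * μ (Metric.closedBall x (D / 2 ^ k)) := by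
        rw [lintegral_tsum fun k =>
          (measurable_const.indicator Metric.isClosed_closedBall.measurableSet).aemeasurable]
        simp only [lintegral_indicator_const Metric.isClosed_closedBall.measurableSet]
    _ ≤ ∑' k : ℕ, ENNReal.ofReal (4 * C * D ^ (γ - 2) * q ^ k) := by
        refine ENNReal.tsum_le_tsum fun k => ?_
        rw [← hterm, ENNReal.ofReal_mul (by positivity)]
        refine mul_le_mul_right ?_ _
        rw [← ofReal_measureReal]
        refine ENNReal.ofReal_le_ofReal (hreg x hx _ (by positivity) ?_)
        exact div_le_self hD.le (one_le_pow₀ one_le_two)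
    _ = ENNReal.ofReal (potentialConst γ D C) := by
        rw [← ENNReal.ofReal_tsum_of_nonneg (fun k => by positivity)
          ((summable_geometric_of_lt_one hq0 hq1).mul_left _), tsum_mul_left,
          tsum_geometric_of_lt_one hq0 hq1]
        rfl

theorem potentialConst_nonneg {γ D C : ℝ} (hγ : 2 < γ) (hD : 0 ≤ D) (hC : 0 ≤ C) :
    0 ≤ potentialConst γ D C := by
  have : (2 : ℝ) ^ (2 - γ) < 1 :=
    Real.rpow_lt_one_of_one_lt_of_neg one_lt_two (by linarith)
  have : 0 ≤ (1 - (2 : ℝ) ^ (2 - γ))⁻¹ := inv_nonneg.2 (by linarith)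
  unfold potentialConst
  positivity

/-- The integrand involves two vertices only, so the integral reduces to `μ × μ`; by Tonelli the
inner integral is the potential. -/
theorem lintegral_infDist_sq_mul_inv_le {γ C : ℝ} (hb : Bornology.IsBounded μ.support)
    (hγ : 2 < γ) (hD : 0 < measureDiam μ) (hμ : IsUpperRegularWith μ γ C) (s : Set H)
    {n : ℕ} {i j : Fin n} (hij : i ≠ j) :
    ∫⁻ X : Fin n → H, ENNReal.ofReal (Metric.infDist (X i) s ^ 2 * (‖X i - X j‖ ^ 2)⁻¹)
      ∂(Measure.pi fun _ => μ) ≤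
    ENNReal.ofReal (potentialConst γ (measureDiam μ) C * ∫ x, Metric.infDist x s ^ 2 ∂μ) := by
  have : SecondCountableTopology H := UniformSpace.secondCountable_of_separable H
  have hm1 : Measurable fun x : H => Metric.infDist x s ^ 2 :=
    ((Metric.continuous_infDist_pt s).pow 2).measurable
  have hm2 : Measurable fun p : H × H => (‖p.1 - p.2‖ ^ 2)⁻¹ := by fun_prop
  have hm : Measurable fun p : H × H =>
      ENNReal.ofReal (Metric.infDist p.1 s ^ 2 * (‖p.1 - p.2‖ ^ 2)⁻¹) :=
    ((hm1.comp measurable_fst).mul hm2).ennreal_ofReal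
  have hpair : Measurable fun X : Fin n → H => (X i, X j) := by fun_prop
  calc _ = ∫⁻ p, ENNReal.ofReal (Metric.infDist p.1 s ^ 2 * (‖p.1 - p.2‖ ^ 2)⁻¹)
        ∂(μ.prod μ) := by rw [← map_pi_pair hij, lintegral_map hm hpair]
    _ = ∫⁻ x, ENNReal.ofReal (Metric.infDist x s ^ 2) *
          ∫⁻ y, ENNReal.ofReal (‖x - y‖ ^ 2)⁻¹ ∂μ ∂μ := by
        rw [lintegral_prod _ hm.aemeasurable]
        refine lintegral_congr fun x => ?_
        rw [← lintegral_const_mul _ (by fun_prop)]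
        exact lintegral_congr fun y => ENNReal.ofReal_mul (sq_nonneg _)
    _ ≤ ∫⁻ x, ENNReal.ofReal (Metric.infDist x s ^ 2) *
          ENNReal.ofReal (potentialConst γ (measureDiam μ) C) ∂μ := by
        refine lintegral_mono_ae ?_
        filter_upwards [ae_mem_support] with x hx
        exact mul_le_mul_right (lintegral_inv_norm_sq_le hb hγ hD hμ hx) _
    _ = _ := by
        rw [lintegral_mul_const _ hm1.ennreal_ofReal, ← ofReal_integral_eq_lintegral_ofReal
          (integrable_infDist_sq hb s) (ae_of_all _ fun _ => sq_nonneg _),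
          mul_comm, ← ENNReal.ofReal_mul
          (potentialConst_nonneg hγ hD.le (zero_le_one.trans hμ.1))]

variable [InnerProductSpace ℝ H]

/-- The estimate for upper regularity of order greater than two. -/
theorem integral_cPol_sq_le_of_two_lt {γ C : ℝ} (hb : Bornology.IsBounded μ.support)
    (hγ : 2 < γ) (hD : 0 < measureDiam μ) (hμ : IsUpperRegularWith μ γ C) {d : ℕ}
    {L : AffineSubspace ℝ H} (hL : L ∈ affineGrassmannian d H) :
    ∫ X : Fin (d + 2) → H, cPol X ^ 2 ∂(Measure.pi fun _ => μ) ≤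
      measureDiam μ ^ 2 * sineConst d * (((d : ℝ) + 2) * (((d : ℝ) + 1) *
        (2 * potentialConst γ (measureDiam μ) C))) *
        ∫ x, Metric.infDist x (L : Set H) ^ 2 ∂μ := by
  have : SecondCountableTopology H := UniformSpace.secondCountable_of_separable H
  set P := potentialConst γ (measureDiam μ) C with hP
  set E := ∫ x, Metric.infDist x (L : Set H) ^ 2 ∂μ with hE
  have hP0 : 0 ≤ P := potentialConst_nonneg hγ hD.le (zero_le_one.trans hμ.1)
  have hE0 : 0 ≤ E := integral_nonneg fun _ => sq_nonneg _
  have hs0 := sineConst_nonneg d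
  set F : Fin (d + 2) → Fin (d + 2) → (Fin (d + 2) → H) → ℝ := fun i j X =>
    Metric.infDist (X i) (L : Set H) ^ 2 * (‖X i - X j‖ ^ 2)⁻¹ with hF
  have hF0 : ∀ i j X, 0 ≤ F i j X := fun i j X => by positivity
  have hFm : ∀ i j, Measurable fun X => ENNReal.ofReal (F i j X) := by
    intro i j
    have hm1 : Measurable fun x : H => Metric.infDist x (L : Set H) ^ 2 :=
      ((Metric.continuous_infDist_pt _).pow 2).measurable
    refine ((hm1.comp (measurable_pi_apply i)).mul ?_).ennreal_ofReal
    fun_prop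
  have hpt : ∀ᵐ X ∂(Measure.pi fun _ : Fin (d + 2) => μ), ENNReal.ofReal (cPol X ^ 2) ≤
      ENNReal.ofReal (measureDiam μ ^ 2 * sineConst d) * ∑ i : Fin (d + 2), ∑ l : Fin (d + 1),
        (ENNReal.ofReal (F (i.succAbove l) i X) + ENNReal.ofReal (F i (i.succAbove l) X)) := by
    filter_upwards [ae_pi_mem_support] with X hX
    have h : cPol X ^ 2 ≤ measureDiam μ ^ 2 * sineConst d * ∑ i : Fin (d + 2),
        ∑ l : Fin (d + 1), (F (i.succAbove l) i X + F i (i.succAbove l) X) := by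
      refine (cPol_sq_le_sum hb hX).trans ?_
      rw [mul_assoc, Finset.mul_sum (a := sineConst d)]
      refine mul_le_mul_of_nonneg_left (Finset.sum_le_sum fun i _ => ?_) (sq_nonneg _)
      refine (polarSine_sq_le_sum hL X i).trans_eq ?_
      congr 1
      refine Finset.sum_congr rfl fun l _ => ?_
      simp only [hF]
      rw [norm_sub_rev (X i), add_mul]
    refine (ENNReal.ofReal_le_ofReal h).trans_eq ?_
    rw [ENNReal.ofReal_mul (by positivity), ENNReal.ofReal_sum_of_nonneg
      fun i _ => Finset.sum_nonneg fun l _ => add_nonneg (hF0 _ _ _) (hF0 _ _ _)]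
    congr 1
    refine Finset.sum_congr rfl fun i _ => ?_
    rw [ENNReal.ofReal_sum_of_nonneg fun l _ => add_nonneg (hF0 _ _ _) (hF0 _ _ _)]
    exact Finset.sum_congr rfl fun l _ => ENNReal.ofReal_add (hF0 _ _ _) (hF0 _ _ _)
  -- In `ENNReal` the singular kernels `F i j` can be integrated without first proving them
  -- integrable.
  rw [integral_eq_lintegral_of_nonneg_ae (ae_of_all _ fun _ => sq_nonneg _)
    (measurable_cPol.pow_const 2).aestronglyMeasurable]
  refine ENNReal.toReal_le_of_le_ofReal (by positivity) ((lintegral_mono_ae hpt).trans ?_)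
  have hmeas : ∀ i : Fin (d + 2), ∀ l : Fin (d + 1), Measurable fun X : Fin (d + 2) → H =>
      ENNReal.ofReal (F (i.succAbove l) i X) + ENNReal.ofReal (F i (i.succAbove l) X) :=
    fun i l => (hFm _ _).add (hFm _ _)
  rw [lintegral_const_mul _ (Finset.measurable_sum _ fun i _ =>
      Finset.measurable_sum _ fun l _ => hmeas i l),
    lintegral_finsetSum _ fun i _ => Finset.measurable_sum _ fun l _ => hmeas i l]
  -- Each vertex has `d + 1` edges, and each edge gives two terms, one for the distance of either
  -- endpoint.
  have hle : ∀ i : Fin (d + 2), ∫⁻ X : Fin (d + 2) → H, ∑ l : Fin (d + 1),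
      (ENNReal.ofReal (F (i.succAbove l) i X) + ENNReal.ofReal (F i (i.succAbove l) X))
        ∂(Measure.pi fun _ => μ) ≤ ENNReal.ofReal (((d : ℝ) + 1) * (2 * (P * E))) := by
    intro i
    rw [lintegral_finsetSum _ fun l _ => hmeas i l]
    have : ∀ l ∈ (Finset.univ : Finset (Fin (d + 1))), ∫⁻ X : Fin (d + 2) → H,
        (ENNReal.ofReal (F (i.succAbove l) i X) + ENNReal.ofReal (F i (i.succAbove l) X))
        ∂(Measure.pi fun _ => μ) ≤ ENNReal.ofReal (2 * (P * E)) := by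
      intro l _
      rw [lintegral_add_left (hFm _ _), two_mul,
        ENNReal.ofReal_add (by positivity) (by positivity)]
      exact add_le_add
        (lintegral_infDist_sq_mul_inv_le hb hγ hD hμ _ (Fin.succAbove_ne i l))
        (lintegral_infDist_sq_mul_inv_le hb hγ hD hμ _ (Fin.succAbove_ne i l).symm)
    refine (Finset.sum_le_sum this).trans_eq ?_
    rw [Finset.sum_const, Finset.card_univ, Fintype.card_fin, nsmul_eq_mul,
      ENNReal.ofReal_mul (p := (d : ℝ) + 1) (by positivity), ← Nat.cast_succ,
      ENNReal.ofReal_natCast]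
  calc _ ≤ ENNReal.ofReal (measureDiam μ ^ 2 * sineConst d) *
        ∑ _i : Fin (d + 2), ENNReal.ofReal (((d : ℝ) + 1) * (2 * (P * E))) :=
        mul_le_mul_right (Finset.sum_le_sum fun i _ => hle i) _
    _ = ENNReal.ofReal (measureDiam μ ^ 2 * sineConst d *
          (((d : ℝ) + 2) * (((d : ℝ) + 1) * (2 * (P * E))))) := by
        have h2 : ((d : ℝ) + 2) = ((d + 2 : ℕ) : ℝ) := by push_cast; ring
        rw [Finset.sum_const, Finset.card_univ, Fintype.card_fin, nsmul_eq_mul,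
          ENNReal.ofReal_mul (p := measureDiam μ ^ 2 * sineConst d) (by positivity),
          ENNReal.ofReal_mul (p := (d : ℝ) + 2) (by positivity), h2, ENNReal.ofReal_natCast]
    _ = _ := by congr 1; ring

end Kernel

/-! ### Tubes about lines and the case `d = 1`, `γ > 1`. -/

section Lines

variable {H : Type*} [NormedAddCommGroup H] [InnerProductSpace ℝ H]

theorem exists_unit_parametrization {L : AffineSubspace ℝ H} (hL : L ∈ affineGrassmannian 1 H) :
    ∃ p v : H, ‖v‖ = 1 ∧ ∀ q ∈ L, ∃ t : ℝ, q = p + t • v := by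
  obtain ⟨⟨p, hp⟩, -, hr⟩ := hL
  obtain ⟨⟨v, hv⟩, hv0, hspan⟩ := finrank_eq_one_iff'.1 hr
  have hv0' : ‖v‖ ≠ 0 := fun h => hv0 (Subtype.ext (norm_eq_zero.1 h))
  refine ⟨p, ‖v‖⁻¹ • v, by rw [norm_smul, norm_inv, norm_norm, inv_mul_cancel₀ hv0'],
    fun q hq => ?_⟩
  obtain ⟨c, hc⟩ := hspan ⟨q - p, L.vsub_mem_direction hq hp⟩
  refine ⟨c * ‖v‖, ?_⟩
  have hc' : c • v = q - p := congrArg Subtype.val hc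
  rw [smul_smul, mul_assoc, mul_inv_cancel₀ hv0', mul_one, hc', add_sub_cancel]

variable [MeasurableSpace H] {μ : Measure H} [IsProbabilityMeasure μ]

/-- An upper-regular measure has little mass in a thin tube about a line. -/
theorem measureReal_tube_le {γ C ε : ℝ} (hb : Bornology.IsBounded μ.support)
    (hμ : IsUpperRegularWith μ γ C) (hε : 0 < ε) (hεD : 3 * ε ≤ measureDiam μ)
    {L : AffineSubspace ℝ H} (hL : L ∈ affineGrassmannian 1 H) :
    μ.real {x | x ∈ μ.support ∧ Metric.infDist x (L : Set H) < ε} ≤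
      (4 * measureDiam μ / ε + 1) * (C * (3 * ε) ^ γ) := by
  set D := measureDiam μ with hDdef
  set S := {x | x ∈ μ.support ∧ Metric.infDist x (L : Set H) < ε} with hS
  have hC : 0 ≤ C := zero_le_one.trans hμ.1
  have hD : 0 < D := by linarith
  obtain ⟨p, v, hv, hpar⟩ := exists_unit_parametrization hL
  -- `t x` is the parameter of a point of the line within `ε` of `x`, with a junk value off `S`.
  have hex : ∀ x, ∃ t : ℝ, x ∈ S → ‖x - (p + t • v)‖ < ε := by
    intro x
    by_cases hx : x ∈ S
    · obtain ⟨q, hq, hxq⟩ := (Metric.infDist_lt_iff hL.1).1 hx.2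
      obtain ⟨t, rfl⟩ := hpar q hq
      exact ⟨t, fun _ => by rwa [dist_eq_norm] at hxq⟩
    · exact ⟨0, fun h => absurd h hx⟩
  choose t ht using hex
  have hline : ∀ x y, ‖(p + t x • v) - (p + t y • v)‖ = |t x - t y| := by
    intro x y
    rw [add_sub_add_left_eq_sub, ← sub_smul, norm_smul, hv, mul_one, Real.norm_eq_abs]
  -- The triangle inequality gives `D + 2ε`, which is at most `2D` since `3ε ≤ D`.
  have hfar : ∀ x ∈ S, ∀ y ∈ S, |t x - t y| ≤ 2 * D := by
    intro x hx y hy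
    rw [← hline]
    have hxy : ‖x - y‖ ≤ D := by
      rw [← dist_eq_norm]; exact Metric.dist_le_diam_of_mem hb hx.1 hy.1
    have h1 : (p + t x • v) - (p + t y • v) =
        (x - y) - (x - (p + t x • v)) + (y - (p + t y • v)) := by abel
    rw [h1]
    have h2 := norm_add_le ((x - y) - (x - (p + t x • v))) (y - (p + t y • v))
    have h3 := norm_sub_le (x - y) (x - (p + t x • v))
    linarith [ht x hx, ht y hy]
  have hnear : ∀ x ∈ S, ∀ y ∈ S, |t x - t y| ≤ ε → dist x y ≤ 3 * ε := by
    intro x hx y hy hxy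
    rw [← hline] at hxy
    have h1 : x - y = ((p + t x • v) - (p + t y • v)) + (x - (p + t x • v)) -
        (y - (p + t y • v)) := by abel
    rw [dist_eq_norm, h1]
    have h2 := norm_sub_le (((p + t x • v) - (p + t y • v)) + (x - (p + t x • v)))
      (y - (p + t y • v))
    have h3 := norm_add_le ((p + t x • v) - (p + t y • v)) (x - (p + t x • v))
    linarith [ht x hx, ht y hy]
  rcases S.eq_empty_or_nonempty with hempty | ⟨x₀, hx₀⟩
  · rw [hempty, measureReal_empty]
    positivity
  -- After a shift by `2D` the parameters lie in `[0, 4D]`, which is cut into `N` cells of length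
  -- `ε`. The cells need not be measurable: only monotonicity and subadditivity are used.
  set N := ⌊4 * D / ε⌋₊ + 1 with hN
  set k : H → ℕ := fun x => ⌊(t x - t x₀ + 2 * D) / ε⌋₊ with hk
  have hnum : ∀ x ∈ S, 0 ≤ (t x - t x₀ + 2 * D) / ε := fun x hx => by
    have := (abs_le.1 (hfar x hx x₀ hx₀)).1
    exact div_nonneg (by linarith) hε.le
  have hcover : S ⊆ ⋃ m ∈ Finset.range N, {x | x ∈ S ∧ k x = m} := by
    intro x hx
    simp only [Set.mem_iUnion, Finset.mem_range]
    refine ⟨k x, Nat.lt_succ_of_le (Nat.floor_mono ?_), hx, rfl⟩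
    have := (abs_le.1 (hfar x hx x₀ hx₀)).2
    exact div_le_div_of_nonneg_right (by linarith) hε.le
  have hcell : ∀ m ∈ Finset.range N, μ.real {x | x ∈ S ∧ k x = m} ≤ C * (3 * ε) ^ γ := by
    intro m _
    rcases Set.eq_empty_or_nonempty {x | x ∈ S ∧ k x = m} with he | ⟨z, hz, hzm⟩
    · rw [he, measureReal_empty]
      positivity
    -- A nonempty cell lies in the `3ε`-ball about one of its own points, which is in the support,
    -- as regularity requires.
    · refine (measureReal_mono ?_).trans (hμ.2 z hz.1 (3 * ε) (by positivity) hεD)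
      rintro x ⟨hx, hxm⟩
      refine hnear x hx z hz ?_
      have hx1 := (Nat.floor_eq_iff (hnum x hx)).1 hxm
      have hz1 := (Nat.floor_eq_iff (hnum z hz)).1 hzm
      rw [le_div_iff₀ hε, div_lt_iff₀ hε] at hx1 hz1
      rw [abs_le]
      constructor <;> linarith [hx1.1, hx1.2, hz1.1, hz1.2]
  calc μ.real S ≤ μ.real (⋃ m ∈ Finset.range N, {x | x ∈ S ∧ k x = m}) :=
        measureReal_mono hcover (measure_ne_top _ _)
    _ ≤ ∑ m ∈ Finset.range N, μ.real {x | x ∈ S ∧ k x = m} := measureReal_biUnion_finset_le _ _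
    _ ≤ N * (C * (3 * ε) ^ γ) := by
        refine (Finset.sum_le_sum hcell).trans_eq ?_
        rw [Finset.sum_const, Finset.card_range, nsmul_eq_mul]
    _ ≤ _ := by
        refine mul_le_mul_of_nonneg_right ?_ (by positivity)
        rw [hN, Nat.cast_succ]
        have := Nat.floor_le (a := 4 * D / ε) (by positivity)
        linarith

/-- The tube bound is `O(ε^(γ - 1))`, which tends to zero since `γ > 1`; the `5` absorbs the summand
`1`, as `ε ≤ D`. -/
theorem exists_tube_radius {γ D C : ℝ} (hγ : 1 < γ) (hD : 0 < D) (hC : 0 < C) :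
    ∃ ε : ℝ, 0 < ε ∧ 3 * ε ≤ D ∧ (4 * D / ε + 1) * (C * (3 * ε) ^ γ) ≤ 1 / 2 := by
  have hcont : Filter.Tendsto (fun ε : ℝ => 5 * D * C * 3 ^ γ * ε ^ (γ - 1))
      (nhdsWithin 0 (Set.Ioi 0)) (nhds 0) := by
    have h := (Real.continuousAt_rpow_const 0 (γ - 1) (Or.inr (by linarith))).tendsto
    rw [Real.zero_rpow (by linarith)] at h
    have h' := (h.mono_left (nhdsWithin_le_nhds (s := Set.Ioi 0))).const_mul (5 * D * C * 3 ^ γ)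
    rwa [mul_zero] at h'
  have h1 := hcont.eventually (Iio_mem_nhds (show (0 : ℝ) < 1 / 2 by norm_num))
  have h2 : ∀ᶠ ε : ℝ in nhdsWithin 0 (Set.Ioi 0), ε ∈ Set.Ioo 0 (D / 3) :=
    Ioo_mem_nhdsGT (by positivity)
  obtain ⟨ε, h3, hε, hεD⟩ := (h1.and h2).exists
  refine ⟨ε, hε, by linarith, le_trans ?_ (le_of_lt h3)⟩
  have h4 : 4 * D / ε + 1 ≤ 5 * D / ε := by
    rw [div_add_one hε.ne']
    exact div_le_div_of_nonneg_right (by linarith) hε.le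
  calc (4 * D / ε + 1) * (C * (3 * ε) ^ γ) ≤ 5 * D / ε * (C * (3 * ε) ^ γ) :=
        mul_le_mul_of_nonneg_right h4 (by positivity)
    _ = _ := by
        rw [Real.mul_rpow (by norm_num) hε.le, Real.rpow_sub_one hε.ne']
        field_simp

variable [BorelSpace H] [TopologicalSpace.SeparableSpace H]

/-- At least half of the mass lies outside the `ε`-tube, and Markov's inequality applies. -/
theorem le_integral_infDist_sq {γ C ε : ℝ} (hb : Bornology.IsBounded μ.support)
    (hμ : IsUpperRegularWith μ γ C) (hε : 0 < ε) (hεD : 3 * ε ≤ measureDiam μ)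
    (hsmall : (4 * measureDiam μ / ε + 1) * (C * (3 * ε) ^ γ) ≤ 1 / 2)
    {L : AffineSubspace ℝ H} (hL : L ∈ affineGrassmannian 1 H) :
    ε ^ 2 / 2 ≤ ∫ x, Metric.infDist x (L : Set H) ^ 2 ∂μ := by
  have h1 := (measureReal_tube_le hb hμ hε hεD hL).trans hsmall
  have h2 := mul_meas_ge_le_integral_of_nonneg
    (ae_of_all μ fun x => sq_nonneg (Metric.infDist x (L : Set H)))
    (integrable_infDist_sq hb (L : Set H)) (ε ^ 2)
  have h3 : (1 : ℝ) ≤ μ.real {x | x ∈ μ.support ∧ Metric.infDist x (L : Set H) < ε} +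
      μ.real {x | ε ^ 2 ≤ Metric.infDist x (L : Set H) ^ 2} := by
    have hs : μ.real μ.support = 1 := by
      have he : μ.support =ᵐ[μ] Set.univ := Filter.eventuallyEq_univ.2 ae_mem_support
      rw [measureReal_def, measure_congr he, measure_univ, ENNReal.toReal_one]
    rw [← hs]
    refine (measureReal_mono fun x hx => ?_).trans (measureReal_union_le _ _)
    rcases lt_or_ge (Metric.infDist x (L : Set H)) ε with h | h
    · exact Or.inl ⟨hx, h⟩
    · exact Or.inr (pow_le_pow_left₀ hε.le h 2)
  have h4 : 1 / 2 ≤ μ.real {x | ε ^ 2 ≤ Metric.infDist x (L : Set H) ^ 2} := by linarith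
  have h5 := mul_le_mul_of_nonneg_left h4 (sq_nonneg ε)
  linarith

end Lines

/-! ### Constants chosen from the parameters, and the final case split. -/

theorem IsRegularWith.isUpperRegularWith {H : Type*} [NormedAddCommGroup H] [MeasurableSpace H]
    {μ : Measure H} {γ C : ℝ} (h : IsRegularWith μ γ C) : IsUpperRegularWith μ γ C :=
  ⟨h.1, fun x hx t ht htD => (h.2 x hx t ht htD).2⟩

theorem exists_const_of_two_lt (d : ℕ) {γ D C : ℝ} (hγ : 2 < γ) (hD : 0 < D) (hC : 1 ≤ C) :
    ∃ K : ℝ, 0 < K ∧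
      ∀ (H : Type*) [NormedAddCommGroup H] [InnerProductSpace ℝ H]
        [TopologicalSpace.SeparableSpace H] [MeasurableSpace H] [BorelSpace H]
        (μ : Measure H) [IsProbabilityMeasure μ],
        Bornology.IsBounded μ.support → measureDiam μ = D → IsUpperRegularWith μ γ C →
        ∫ X : Fin (d + 2) → H, cPol X ^ 2 ∂(Measure.pi fun _ => μ) ≤ K * lsError μ d ^ 2 := by
  have hP := potentialConst_nonneg hγ hD.le (zero_le_one.trans hC)
  have hs := sineConst_nonneg d
  -- Only nonnegativity of the factors is at hand; the summand `1` makes the constant positive.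
  refine ⟨D ^ 2 * sineConst d * (((d : ℝ) + 2) * (((d : ℝ) + 1) * (2 * potentialConst γ D C))) + 1,
    by positivity, ?_⟩
  intro H _ _ _ _ _ μ _ hb hdiam hμ
  refine le_mul_lsError_sq (by positivity)
    (fun h => by simp [cPol_eq_zero_of_isEmpty h]) fun L hL => ?_
  subst hdiam
  refine (integral_cPol_sq_le_of_two_lt hb hγ hD hμ hL).trans ?_
  exact mul_le_mul_of_nonneg_right (le_add_of_nonneg_right zero_le_one)
    (integral_nonneg fun _ => sq_nonneg _)

/-- The left side is bounded by a constant `A`, and the squared error of every line is at least `ε²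
/ 2`, with `ε` depending only on `γ`, `D`, `C`. -/
theorem exists_const_of_one_lt {γ D C : ℝ} (hγ : 1 < γ) (hD : 0 < D) (hC : 1 ≤ C) :
    ∃ K : ℝ, 0 < K ∧
      ∀ (H : Type*) [NormedAddCommGroup H] [InnerProductSpace ℝ H]
        [TopologicalSpace.SeparableSpace H] [MeasurableSpace H] [BorelSpace H]
        (μ : Measure H) [IsProbabilityMeasure μ],
        Bornology.IsBounded μ.support → measureDiam μ = D → IsUpperRegularWith μ γ C →
        ∫ X : Fin (1 + 2) → H, cPol X ^ 2 ∂(Measure.pi fun _ => μ) ≤ K * lsError μ 1 ^ 2 := by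
  obtain ⟨ε, hε, hεD, hsmall⟩ := exists_tube_radius hγ hD (zero_lt_one.trans_le hC)
  set A := D ^ 2 * ((((1 : ℕ) : ℝ) + 2) * sineConst 1) with hA
  have hA0 : 0 ≤ A := by have := sineConst_nonneg 1; positivity
  refine ⟨A / (ε ^ 2 / 2) + 1, by positivity, ?_⟩
  intro H _ _ _ _ _ μ _ hb hdiam hμ
  refine le_mul_lsError_sq (by positivity)
    (fun h => by simp [cPol_eq_zero_of_isEmpty h]) fun L hL => ?_
  have h1 : ε ^ 2 / 2 ≤ ∫ x, Metric.infDist x (L : Set H) ^ 2 ∂μ := by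
    subst hdiam
    exact le_integral_infDist_sq hb hμ hε hεD hsmall hL
  have h2 : ∫ X : Fin (1 + 2) → H, cPol X ^ 2 ∂(Measure.pi fun _ => μ) ≤ A := by
    rw [hA, ← hdiam]
    exact integral_cPol_sq_le hb
  calc _ ≤ A := h2
    _ = A / (ε ^ 2 / 2) * (ε ^ 2 / 2) := by field_simp
    _ ≤ _ := mul_le_mul (le_add_of_nonneg_right zero_le_one) h1 (by positivity) (by positivity)

end GCN

end

/-- `K` must be fixed before `H` and `μ`, so the cases are split on the parameters; values that no
measure can satisfy get `K = 1`. -/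
theorem mainTheorem2 (d : ℕ) (γ D C : ℝ) :
    ∃ K : ℝ, 0 < K ∧
      ∀ (H : Type*) [NormedAddCommGroup H] [InnerProductSpace ℝ H] [CompleteSpace H]
        [TopologicalSpace.SeparableSpace H] [MeasurableSpace H] [BorelSpace H]
        (μ : Measure H) [IsProbabilityMeasure μ],
        Bornology.IsBounded μ.support →
        GCN.measureDiam μ = D →
        ((2 < γ ∧ GCN.IsUpperRegularWith μ γ C) ∨
          (d = 1 ∧ 1 < γ ∧ GCN.IsRegularWith μ γ C)) →
        Integrable (fun X : Fin (d + 2) → H => GCN.cPol X ^ 2) (Measure.pi fun _ => μ) ∧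
          ∫ X : Fin (d + 2) → H, GCN.cPol X ^ 2 ∂(Measure.pi fun _ => μ) ≤
            K * GCN.lsError μ d ^ 2 := by
  -- For `D ≤ 0` the support has diameter zero, so the uniform bound makes the left side
  -- nonpositive.
  rcases le_or_gt D 0 with hD | hD
  · refine ⟨1, one_pos, ?_⟩
    intro H _ _ _ _ _ _ μ _ hb hdiam _
    refine ⟨GCN.integrable_cPol_sq hb, (GCN.integral_cPol_sq_le hb).trans ?_⟩
    have h0 : GCN.measureDiam μ = 0 := le_antisymm (hdiam.trans_le hD) Metric.diam_nonneg
    rw [h0, zero_pow two_ne_zero, zero_mul]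
    positivity
  by_cases hC : 1 ≤ C
  swap
  · refine ⟨1, one_pos, ?_⟩
    rintro H _ _ _ _ _ _ μ _ - - (⟨-, h⟩ | ⟨-, -, h⟩)
    · exact absurd h.1 hC
    · exact absurd h.1 hC
  by_cases h2 : 2 < γ
  · obtain ⟨K, hK, h⟩ := GCN.exists_const_of_two_lt d h2 hD hC
    refine ⟨K, hK, ?_⟩
    intro H _ _ _ _ _ _ μ _ hb hdiam hreg
    refine ⟨GCN.integrable_cPol_sq hb, h H μ hb hdiam ?_⟩
    rcases hreg with ⟨-, hreg⟩ | ⟨-, -, hreg⟩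
    · exact hreg
    · exact hreg.isUpperRegularWith
  by_cases h1 : d = 1 ∧ 1 < γ
  · obtain ⟨rfl, hγ⟩ := h1
    obtain ⟨K, hK, h⟩ := GCN.exists_const_of_one_lt hγ hD hC
    refine ⟨K, hK, ?_⟩
    intro H _ _ _ _ _ _ μ _ hb hdiam hreg
    refine ⟨GCN.integrable_cPol_sq hb, h H μ hb hdiam ?_⟩
    rcases hreg with ⟨h', -⟩ | ⟨-, -, hreg⟩
    · exact absurd h' h2
    · exact hreg.isUpperRegularWith
  · refine ⟨1, one_pos, ?_⟩
    rintro H _ _ _ _ _ _ μ _ - - (⟨h', -⟩ | ⟨hd, hγ, -⟩)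
    · exact absurd h' h2
    · exact absurd ⟨hd, hγ⟩ h1
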